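/- Let $c, L, g, \rho > 0$ and $P_{atm}\in\mathbb R$. Consider an irrotational regular (Stokes) wave train of period $L$ travelling at speed $c$ over water of infinite depth. That is, in the frame moving with the wave, let the free surface $y=\eta(x)$, the velocity field $(u,v)$ and the pressure $P$ be $L$-periodic in $x$, smooth up to the free surface of the fluid domain $\overline{D_\eta}=\{(x,y): -\infty<y\le\eta(x)\}$, and satisfy there $$(u-c)u_x+vu_y=-\tfrac1\rho P_x,\qquad (u-c)v_x+vv_y=-\tfrac1\rho P_y-g,\qquad u_x+v_y=0,\qquad u_y=v_x,$$ together with $v=(u-c)\eta_x$ and $P=P_{atm}$ on $y=\eta(x)$, and $(u,v)\to(0,0)$ as $y\to-\infty$, uniformly in $x\in\mathbb R$. Suppose that the wave has a single crest per period, placed at $x=0$, and a single trough, placed at $x=L/2$, that $\eta$ is strictly monotone between successive crests and troughs, and that $\eta,u,P$ are even and $v$ is odd in $x$. Suppose also that there is no underlying current, i.e. $\frac1L\int_0^L u(x,y_0)\,dx=0$ for every $y_0<\eta(L/2)$. Then the dynamic pressure $$p(x,y)=P(x,y)-(P_{atm}-\rho g y)$$ attains its maximum over $\overline{D_\eta}$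 at the wave crest $(0,\eta(0))$ and its minimum over $\overline{D_\eta}$ at the wave trough $(L/2,\eta(L/2))$. Moreover, up to translation by multiples of $L$ in $x$, these are the only points of $\overline{D_\eta}$ at which the maximum, respectively the minimum, is attained; in particular neither is attained in the interior. -/

import Mathlib

open Set Filter Topology
open scoped ContDiff

namespace DeepWater

/-- The closed fluid domain `{(x, y) : -∞ < y ≤ η x}` below the free surface `y = η x`
in water of infinite depth. -/
def fluidDomain (η : ℝ → ℝ) : Set (ℝ × ℝ) :=
  {q | q.2 ≤ η q.1}

/-- Partial derivative in the horizontal variable. -/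
noncomputable def dx (f : ℝ → ℝ → ℝ) (x y : ℝ) : ℝ :=
  deriv (fun s => f s y) x

/-- Partial derivative in the vertical variable. -/
noncomputable def dy (f : ℝ → ℝ → ℝ) (x y : ℝ) : ℝ :=
  deriv (fun s => f x s) y

/-- The governing equations, in the frame moving with the wave, of a two-dimensional steady
`L`-periodic irrotational gravity water wave travelling at speed `c` over water of infinite depth:
`η` is the free surface, `(u, v)` the velocity field, `P` the pressure, `g` the acceleration of
gravity, `ρ` the density and `Patm` the atmospheric pressure.  The solution is smooth up to the
free surface, so the partial differential equations, imposed in the open domain, extend to the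
free surface by continuity.  All conditions concern only points of the fluid domain. -/
structure IsIrrotationalWave (c L g ρ Patm : ℝ) (η : ℝ → ℝ) (u v P : ℝ → ℝ → ℝ) : Prop where
  smooth_surface : ContDiff ℝ ∞ η
  smooth_u : ContDiffOn ℝ ∞ (fun q : ℝ × ℝ => u q.1 q.2) (fluidDomain η)
  smooth_v : ContDiffOn ℝ ∞ (fun q : ℝ × ℝ => v q.1 q.2) (fluidDomain η)
  smooth_P : ContDiffOn ℝ ∞ (fun q : ℝ × ℝ => P q.1 q.2) (fluidDomain η)
  periodic_surface : ∀ x, η (x + L) = η x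
  periodic_u : ∀ x y, y ≤ η x → u (x + L) y = u x y
  periodic_v : ∀ x y, y ≤ η x → v (x + L) y = v x y
  periodic_P : ∀ x y, y ≤ η x → P (x + L) y = P x y
  euler_x : ∀ x y, y < η x →
    (u x y - c) * dx u x y + v x y * dy u x y = -(1 / ρ) * dx P x y
  euler_y : ∀ x y, y < η x →
    (u x y - c) * dx v x y + v x y * dy v x y = -(1 / ρ) * dy P x y - g
  incompressible : ∀ x y, y < η x → dx u x y + dy v x y = 0
  irrotational : ∀ x y, y < η x → dy u x y = dx v x y
  kinematic : ∀ x, v x (η x) = (u x (η x) - c) * deriv η x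
  dynamic : ∀ x, P x (η x) = Patm
  decay_u : TendstoUniformly (fun y x => u x y) (fun _ => 0) atBot
  decay_v : TendstoUniformly (fun y x => v x y) (fun _ => 0) atBot

/-- A regular (Stokes) wave train: a solution of the governing equations with a single crest and
a single trough per period, strictly monotone between successive crests and troughs, with `η`, `u`
and `P` symmetric and `v` antisymmetric about the crest line.  The crest is placed at `x = 0` and
the trough at `x = L / 2`. -/
structure IsRegularWaveTrain (c L g ρ Patm : ℝ) (η : ℝ → ℝ) (u v P : ℝ → ℝ → ℝ) : Prop
    extends IsIrrotationalWave c L g ρ Patm η u v P where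
  strictAnti_crest_trough : StrictAntiOn η (Icc 0 (L / 2))
  strictMono_trough_crest : StrictMonoOn η (Icc (L / 2) L)
  symm_surface : ∀ x, η (-x) = η x
  symm_u : ∀ x y, y ≤ η x → u (-x) y = u x y
  symm_P : ∀ x y, y ≤ η x → P (-x) y = P x y
  antisymm_v : ∀ x y, y ≤ η x → v (-x) y = -v x y

/-- The mean over one period of the horizontal velocity at the level `y₀`. -/
noncomputable def underlyingCurrent (L : ℝ) (u : ℝ → ℝ → ℝ) (y₀ : ℝ) : ℝ :=
  (1 / L) * ∫ x in (0 : ℝ)..L, u x y₀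

/-- There is no underlying current: the mean horizontal velocity vanishes at every level below
the wave trough. -/
def NoUnderlyingCurrent (L : ℝ) (η : ℝ → ℝ) (u : ℝ → ℝ → ℝ) : Prop :=
  ∀ y₀, y₀ < η (L / 2) → underlyingCurrent L u y₀ = 0

/-- The dynamic pressure: the total pressure minus the hydrostatic pressure `Patm - ρ g y`. -/
def dynamicPressure (g ρ Patm : ℝ) (P : ℝ → ℝ → ℝ) (q : ℝ × ℝ) : ℝ :=
  P q.1 q.2 - (Patm - ρ * g * q.2)

end DeepWater

/-!
Write `z = x + i y`. The complex velocity `f = (u - c) - i v` is holomorphic below the surface,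
`L`-periodic, and tends to `-c` at infinite depth. By Bernoulli's law the dynamic pressure is
`ρ / 2 * (K - |f| ^ 2)` for a constant `K`, and on the surface it equals `ρ g η`. So the theorem
says that at interior points `|f|` lies strictly between its values at the crest and the trough.

The tool is Cauchy's theorem over one period (`IsPeriodicHolomorphic.integral_graph_eq`): the
integral of `G dz` along the graph of any periodic `h` is `L` times the limit of `G` at infinite
depth. Taking `h` constant, the limit is a mean of values of `G`, hence infinite depth never gives
a strict maximum of `|G|`, and the strong maximum principle holds in the unbounded region
(`IsPeriodicHolomorphic.eq_const_of_le_norm`). Applied to `f`, it gives the upper bound, because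
`f` constant would make the surface flat.

The lower bound is the same principle for `1 / f`, and requires that `f` has no zero. Off the crests
the surface speed is positive, because there `η` is less than at the crest and the speed squared is
`K - 2 g η`. Hence `u - c` has one sign along the surface. The circulation along the surface is
`-c L < 0` by Cauchy's theorem with `h = η`, and it is the integral of `(u - c) (1 + η' ^ 2)`, so
`u - c ≤ 0` on the surface. The maximum principle for `exp f` then gives `u - c < 0` in the interior.
No separate argument is needed to exclude `f = 0` at the crest: in that case the lower bound says
no more than that `f` has no interior zero.
-/

namespace DeepWater

open Complex intervalIntegral

/-! ### Periodic holomorphic functions below a graph -/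

/-- The open region `y < h x` of the complex plane, where `z = x + i y`. -/
def below (h : ℝ → ℝ) : Set ℂ := {z | z.im < h z.re}

/-- The closed region `y ≤ h x` of the complex plane, where `z = x + i y`. -/
def closedBelow (h : ℝ → ℝ) : Set ℂ := {z | z.im ≤ h z.re}

/-- The function `G` is holomorphic below the graph of `h`, continuous up to the graph,
`L`-periodic, and tends to `ℓ` as `y → -∞`, uniformly in `x`. -/
structure IsPeriodicHolomorphic (h : ℝ → ℝ) (L : ℝ) (G : ℂ → ℂ) (ℓ : ℂ) : Prop where
  continuousOn : ContinuousOn G (closedBelow h)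
  differentiableOn : DifferentiableOn ℂ G (below h)
  periodic : ∀ z ∈ closedBelow h, G (z + L) = G z
  tendsto : Tendsto G (comap im atBot) (𝓝 ℓ)

theorem below_subset_closedBelow (h : ℝ → ℝ) : below h ⊆ closedBelow h :=
  fun z hz => le_of_lt (show z.im < h z.re from hz)

theorem isOpen_below {h : ℝ → ℝ} (hh : Continuous h) : IsOpen (below h) :=
  isOpen_lt continuous_im (hh.comp continuous_re)

theorem isClosed_closedBelow {h : ℝ → ℝ} (hh : Continuous h) : IsClosed (closedBelow h) :=
  isClosed_le continuous_im (hh.comp continuous_re)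

theorem isPreconnected_below {h : ℝ → ℝ} (hh : Continuous h) : IsPreconnected (below h) := by
  have hpre : IsPreconnected ((univ : Set ℝ) ×ˢ Ioi (0 : ℝ)) :=
    isPreconnected_univ.prod isPreconnected_Ioi
  have hcont : Continuous fun p : ℝ × ℝ => (p.1 : ℂ) + ((h p.1 - p.2 : ℝ) : ℂ) * I := by fun_prop
  convert hpre.image _ hcont.continuousOn using 1
  ext z
  constructor
  · intro hz
    refine ⟨(z.re, h z.re - z.im), ⟨mem_univ _, mem_Ioi.2 (sub_pos.2 hz)⟩, ?_⟩
    simp [re_add_im]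
  · rintro ⟨p, ⟨-, hp⟩, rfl⟩
    have : (0 : ℝ) < p.2 := hp
    simpa [below] using this

theorem closedBelow_subset_closure_below (h : ℝ → ℝ) : closedBelow h ⊆ closure (below h) := by
  intro z hz
  have hlim : Tendsto (fun t : ℝ => z - t * I) (𝓝[>] 0) (𝓝 z) := by
    have : Continuous fun t : ℝ => z - t * I := by fun_prop
    simpa using (this.tendsto 0).mono_left nhdsWithin_le_nhds
  refine mem_closure_of_tendsto hlim ?_
  filter_upwards [self_mem_nhdsWithin] with t ht
  have h0 : (0 : ℝ) < t := ht
  have h1 : z.im ≤ h z.re := hz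
  have h2 : z.im - t < h z.re := by linarith
  simpa [below] using h2

/-- Push the graph down by `t`: the integral of `G dz` over one period of the lowered graph does
not depend on `t`, because the side contributions cancel by periodicity. -/
theorem IsPeriodicHolomorphic.integral_lowered_eq {h : ℝ → ℝ} {L : ℝ} {G : ℂ → ℂ} {ℓ : ℂ}
    (hG : IsPeriodicHolomorphic h L G ℓ) (hh : ContDiff ℝ 2 h) (hper : ∀ x, h (x + L) = h x)
    {T : ℝ} (hT : 0 ≤ T) :
    ∫ x in (0 : ℝ)..L, G (x + (h x - T : ℝ) * I) * (1 + deriv h x * I) =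
      ∫ x in (0 : ℝ)..L, G (x + h x * I) * (1 + deriv h x * I) := by
  let γ : ℝ × ℝ → ℂ := fun p => (p.1 : ℂ) + ((h p.1 - p.2 : ℝ) : ℂ) * I
  let D : ℝ × ℝ → ℂ := fun p => 1 + deriv h p.1 * I
  have hh1 : Differentiable ℝ h := hh.differentiable (by norm_num)
  have hcd : ContDiff ℝ 1 (deriv h) := by
    have : ContDiff ℝ (1 + 1) h := by simpa [one_add_one_eq_two] using hh
    exact ((contDiff_succ_iff_deriv.1 this).2.2)
  have hdd : Differentiable ℝ (deriv h) := hcd.differentiable (by norm_num)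
  have hhc : Continuous h := hh.continuous
  have hdc : Continuous (deriv h) := hcd.continuous
  have hγc : Continuous γ := by fun_prop
  have hDc : Continuous D := by fun_prop
  let γ' : ℝ × ℝ → ℝ × ℝ →L[ℝ] ℂ := fun p =>
    (ContinuousLinearMap.fst ℝ ℝ ℝ).smulRight (1 + deriv h p.1 * I : ℂ) +
      (ContinuousLinearMap.snd ℝ ℝ ℝ).smulRight (-I)
  let D' : ℝ × ℝ → ℝ × ℝ →L[ℝ] ℂ := fun p =>
    (ContinuousLinearMap.fst ℝ ℝ ℝ).smulRight (deriv (deriv h) p.1 * I : ℂ)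
  have hγd : ∀ p, HasFDerivAt γ (γ' p) p := by
    intro p
    have e1 : HasFDerivAt (fun p : ℝ × ℝ => p.1) (ContinuousLinearMap.fst ℝ ℝ ℝ) p :=
      hasFDerivAt_fst
    have e2 : HasFDerivAt (fun p : ℝ × ℝ => p.2) (ContinuousLinearMap.snd ℝ ℝ ℝ) p :=
      hasFDerivAt_snd
    have e3 := ((hh1 p.1).hasDerivAt.comp_hasFDerivAt p e1).sub e2
    have e4 := (ofRealCLM.hasFDerivAt.comp p e1).add
      ((ofRealCLM.hasFDerivAt.comp p e3).mul_const I)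
    refine e4.congr_fderiv ?_
    ext <;> simp [γ']
    ring
  have hDd : ∀ p, HasFDerivAt D (D' p) p := by
    intro p
    have e1 : HasFDerivAt (fun p : ℝ × ℝ => p.1) (ContinuousLinearMap.fst ℝ ℝ ℝ) p :=
      hasFDerivAt_fst
    have e3 := (hdd p.1).hasDerivAt.comp_hasFDerivAt p e1
    have e4 := ((ofRealCLM.hasFDerivAt.comp p e3).mul_const I).const_add 1
    refine e4.congr_fderiv ?_
    ext <;> simp [D']
    ring
  have hmem : ∀ p : ℝ × ℝ, 0 ≤ p.2 → γ p ∈ closedBelow h := by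
    intro p hp; simpa [γ, closedBelow] using hp
  have hmem' : ∀ p : ℝ × ℝ, 0 < p.2 → γ p ∈ below h := by
    intro p hp; simpa [γ, below] using hp
  have hGγc : ContinuousOn (fun p => G (γ p)) (uIcc 0 L ×ˢ uIcc 0 T) := by
    refine hG.continuousOn.comp hγc.continuousOn fun p hp => hmem p ?_
    have := hp.2
    rw [uIcc_of_le hT] at this
    exact this.1
  have hGγd : ∀ p : ℝ × ℝ, 0 < p.2 →
      HasFDerivAt (fun p => G (γ p)) (deriv G (γ p) • γ' p) p := by
    intro p hp
    have := (hG.differentiableOn.differentiableAt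
      ((isOpen_below hhc).mem_nhds (hmem' p hp))).hasDerivAt
    exact this.comp_hasFDerivAt p (hγd p)
  have hpos : ∀ p ∈ Ioo (min 0 L) (max 0 L) ×ˢ Ioo (min 0 T) (max 0 T) \ (∅ : Set (ℝ × ℝ)),
      (0 : ℝ) < p.2 := by
    intro p hp
    have := hp.1.2.1
    rwa [min_eq_left hT] at this
  -- With `γ (x, t) = x + i (h x - t)` the pulled back form is `G dz = G (1 + i h') dx - i G dt`,
  -- and it is closed.
  have hdiv := MeasureTheory.integral2_divergence_prod_of_hasFDerivAt_off_countable
    (fun p => -I * G (γ p)) (fun p => -(G (γ p) * D p))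
    (fun p => (-I) • (deriv G (γ p) • γ' p))
    (fun p => -(G (γ p) • D' p + D p • (deriv G (γ p) • γ' p))) 0 0 L T ∅ countable_empty
    (continuousOn_const.mul hGγc) (hGγc.mul hDc.continuousOn).neg
    (fun p hp => (hGγd p (hpos p hp)).const_mul (-I))
    (fun p hp => ((hGγd p (hpos p hp)).mul (hDd p)).neg)
    (by
      refine MeasureTheory.integrableOn_zero.congr_fun (fun p _ => ?_)
        (measurableSet_uIcc.prod measurableSet_uIcc)
      simp [γ', D', D]
      ring)
  have hzero : ∀ p : ℝ × ℝ, ((-I) • (deriv G (γ p) • γ' p)) (1, 0) +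
      (-(G (γ p) • D' p + D p • (deriv G (γ p) • γ' p))) (0, 1) = 0 := by
    intro p
    simp [γ', D', D]
    ring
  have hside : ∫ y in (0 : ℝ)..T, -I * G (γ (L, y)) = ∫ y in (0 : ℝ)..T, -I * G (γ (0, y)) := by
    refine integral_congr fun y hy => ?_
    rw [uIcc_of_le hT] at hy
    have e : γ (L, y) = γ (0, y) + L := by
      have := hper 0
      rw [zero_add] at this
      simp only [γ, this, ofReal_zero]
      ring
    simp only [e, hG.periodic _ (hmem (0, y) hy.1)]
  simp only [hzero, integral_zero, hside, add_sub_cancel_right, integral_neg] at hdiv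
  simp only [γ, D, sub_zero] at hdiv
  linear_combination hdiv

/-- Cauchy's theorem for one period: the mean of `G dz` along the graph is the limit of `G` at
infinite depth. -/
theorem IsPeriodicHolomorphic.integral_graph_eq {h : ℝ → ℝ} {L : ℝ} {G : ℂ → ℂ} {ℓ : ℂ}
    (hG : IsPeriodicHolomorphic h L G ℓ) (hh : ContDiff ℝ 2 h) (hper : ∀ x, h (x + L) = h x) :
    ∫ x in (0 : ℝ)..L, G (x + h x * I) * (1 + deriv h x * I) = L * ℓ := by
  have hhc : Continuous h := hh.continuous
  have hdc : Continuous (deriv h) := hh.continuous_deriv (by norm_num)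
  obtain ⟨B, hB⟩ := (isCompact_uIcc (a := (0 : ℝ)) (b := L)).bddAbove_image hhc.continuousOn
  have hlim : Tendsto (fun T : ℝ => ∫ x in (0 : ℝ)..L,
      G (x + (h x - T : ℝ) * I) * (1 + deriv h x * I)) atTop
      (𝓝 (∫ x in (0 : ℝ)..L, ℓ * (1 + deriv h x * I))) := by
    refine tendsto_integral_filter_of_dominated_convergence
      (fun x => (‖ℓ‖ + 1) * ‖(1 + deriv h x * I : ℂ)‖) ?_ ?_ ?_ ?_
    · filter_upwards [eventually_ge_atTop 0] with T hT
      refine Continuous.aestronglyMeasurable ?_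
      have : Continuous fun x : ℝ => G (x + (h x - T : ℝ) * I) :=
        hG.continuousOn.comp_continuous (by fun_prop) (by intro x; simpa [closedBelow] using hT)
      exact this.mul (by fun_prop)
    · have h1 : ∀ᶠ z in comap im atBot, ‖G z‖ < ‖ℓ‖ + 1 :=
        hG.tendsto.norm.eventually_lt_const (by linarith)
      obtain ⟨s, hs, hsub⟩ := h1
      obtain ⟨Y, hY⟩ := mem_atBot_sets.1 hs
      filter_upwards [eventually_ge_atTop (B - Y)] with T hT
      refine Eventually.of_forall fun x hx => ?_
      rw [norm_mul]
      refine mul_le_mul_of_nonneg_right (le_of_lt (hsub (hY _ ?_))) (norm_nonneg _)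
      have := hB (mem_image_of_mem h (uIoc_subset_uIcc hx))
      simp
      linarith
    · exact Continuous.intervalIntegrable (by fun_prop) _ _
    · refine Eventually.of_forall fun x _ => Tendsto.mul_const _ (hG.tendsto.comp ?_)
      rw [tendsto_comap_iff]
      have : (im ∘ fun T : ℝ => (x : ℂ) + (h x - T : ℝ) * I) = fun T : ℝ => h x - T := by
        ext T; simp
      rw [this]
      exact tendsto_atBot_add_const_left _ _ tendsto_neg_atTop_atBot
  have hconst : Tendsto (fun T : ℝ => ∫ x in (0 : ℝ)..L,
      G (x + (h x - T : ℝ) * I) * (1 + deriv h x * I)) atTop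
      (𝓝 (∫ x in (0 : ℝ)..L, G (x + h x * I) * (1 + deriv h x * I))) := by
    refine tendsto_const_nhds.congr' ?_
    filter_upwards [eventually_ge_atTop 0] with T hT
    exact (hG.integral_lowered_eq hh hper hT).symm
  rw [tendsto_nhds_unique hconst hlim, integral_const_mul]
  have hFTC : ∫ x in (0 : ℝ)..L, deriv h x = 0 := by
    rw [integral_deriv_eq_sub (fun x _ => hh.differentiable (by norm_num) x)
      (hdc.intervalIntegrable _ _)]
    have := hper 0
    rw [zero_add] at this
    rw [this, sub_self]
  rw [integral_add (by simp) (Continuous.intervalIntegrable (by fun_prop) _ _),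
    integral_mul_const, intervalIntegral.integral_ofReal, hFTC]
  simp [mul_comm]

/-- Used with `Φ = exp` and with `Φ w = w⁻¹`; the latter is singular at `0`, so `Φ` is only asked
to be regular at the values of `G` and at its limit. -/
theorem IsPeriodicHolomorphic.comp {h : ℝ → ℝ} {L : ℝ} {G Φ : ℂ → ℂ} {ℓ : ℂ}
    (hG : IsPeriodicHolomorphic h L G ℓ) (hΦ : ∀ z ∈ closedBelow h, DifferentiableAt ℂ Φ (G z))
    (hΦℓ : ContinuousAt Φ ℓ) : IsPeriodicHolomorphic h L (fun z => Φ (G z)) (Φ ℓ) where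
  continuousOn := fun z hz =>
    (hΦ z hz).continuousAt.comp_continuousWithinAt (hG.continuousOn z hz)
  differentiableOn := fun z hz =>
    (hΦ z (below_subset_closedBelow h hz)).comp_differentiableWithinAt z (hG.differentiableOn z hz)
  periodic := fun z hz => by rw [hG.periodic z hz]
  tendsto := hΦℓ.tendsto.comp hG.tendsto

theorem add_int_mul_eq_of_periodic {h : ℝ → ℝ} {L : ℝ} (hper : ∀ x, h (x + L) = h x) (x : ℝ)
    (n : ℤ) : h (x + n * L) = h x := by
  have := Function.Periodic.zsmul hper n x
  rwa [zsmul_eq_mul] at this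

theorem exists_add_int_mul_mem_Ico {L : ℝ} (hL : 0 < L) (x : ℝ) :
    ∃ n : ℤ, x + n * L ∈ Ico 0 L := by
  obtain ⟨n, hn, -⟩ := existsUnique_add_zsmul_mem_Ico hL x 0
  exact ⟨n, by simpa using hn⟩

theorem exists_le_le_of_periodic {h : ℝ → ℝ} {L : ℝ} (hL : 0 < L) (hhc : Continuous h)
    (hper : ∀ x, h (x + L) = h x) : ∃ a b, ∀ x, a ≤ h x ∧ h x ≤ b := by
  obtain ⟨b, hb⟩ := (isCompact_Icc (a := (0 : ℝ)) (b := L)).bddAbove_image hhc.continuousOn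
  obtain ⟨a, ha⟩ := (isCompact_Icc (a := (0 : ℝ)) (b := L)).bddBelow_image hhc.continuousOn
  refine ⟨a, b, fun x => ?_⟩
  obtain ⟨n, hn⟩ := exists_add_int_mul_mem_Ico hL x
  rw [← add_int_mul_eq_of_periodic hper x n]
  exact ⟨ha (mem_image_of_mem h (Ico_subset_Icc_self hn)),
    hb (mem_image_of_mem h (Ico_subset_Icc_self hn))⟩

theorem IsPeriodicHolomorphic.add_int_mul {h : ℝ → ℝ} {L : ℝ} {G : ℂ → ℂ} {ℓ : ℂ}
    (hG : IsPeriodicHolomorphic h L G ℓ) (hper : ∀ x, h (x + L) = h x) {z : ℂ}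
    (hz : z ∈ closedBelow h) (n : ℤ) : G (z + n * L) = G z := by
  have hmem : ∀ m : ℤ, z + m * L ∈ closedBelow h := by
    intro m
    have : z.im ≤ h z.re := hz
    simpa [closedBelow, add_int_mul_eq_of_periodic hper] using this
  have hstep : ∀ m : ℤ, G (z + (m + 1 : ℤ) * L) = G (z + m * L) := by
    intro m
    rw [← hG.periodic _ (hmem m)]
    congr 1
    push_cast
    ring
  induction n using Int.induction_on with
  | zero => simp
  | succ k ih => rw [hstep, ih]
  | pred k ih =>
    rw [← ih]
    have := hstep (-(k : ℤ) - 1)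
    rw [sub_add_cancel] at this
    exact this.symm

/-- Some value of `|G|` is at least that at infinite depth, because the limit is the mean of `G`
over a period of any horizontal line lying below the graph. -/
theorem IsPeriodicHolomorphic.exists_norm_limit_le {h : ℝ → ℝ} {L : ℝ} {G : ℂ → ℂ} {ℓ : ℂ}
    (hG : IsPeriodicHolomorphic h L G ℓ) (hL : 0 < L) (hhc : Continuous h)
    (hper : ∀ x, h (x + L) = h x) : ∃ z ∈ below h, ‖ℓ‖ ≤ ‖G z‖ := by
  obtain ⟨a, b, ha⟩ := exists_le_le_of_periodic hL hhc hper
  have hsub : closedBelow (fun _ => a - 1) ⊆ below h := by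
    intro z hz
    have h1 : z.im ≤ a - 1 := hz
    have h2 := (ha z.re).1
    change z.im < h z.re
    linarith
  have hsub' := hsub.trans (below_subset_closedBelow h)
  have hline : IsPeriodicHolomorphic (fun _ => a - 1) L G ℓ :=
    ⟨hG.continuousOn.mono hsub',
      hG.differentiableOn.mono ((below_subset_closedBelow _).trans hsub),
      fun z hz => hG.periodic z (hsub' hz), hG.tendsto⟩
  have hmean := hline.integral_graph_eq contDiff_const (fun _ => rfl)
  simp only [deriv_const', ofReal_zero, zero_mul, add_zero, mul_one] at hmean
  have hmem : ∀ x : ℝ, (x : ℂ) + (a - 1 : ℝ) * I ∈ closedBelow (fun _ => a - 1) := by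
    intro x; simp [closedBelow]
  have hcont : Continuous fun x : ℝ => G (x + (a - 1 : ℝ) * I) :=
    hline.continuousOn.comp_continuous (by fun_prop) hmem
  obtain ⟨x₀, -, hmax⟩ := (isCompact_Icc (a := (0 : ℝ)) (b := L)).exists_isMaxOn
    (nonempty_Icc.2 hL.le) hcont.norm.continuousOn
  refine ⟨_, hsub (hmem x₀), ?_⟩
  have hle := norm_integral_le_of_norm_le_const (a := 0) (b := L)
    (f := fun x : ℝ => G (x + (a - 1 : ℝ) * I)) (C := ‖G (x₀ + (a - 1 : ℝ) * I)‖) (by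
      intro x hx
      rw [uIoc_of_le hL.le] at hx
      exact hmax (Ioc_subset_Icc_self hx))
  rw [hmean, norm_mul, norm_real, Real.norm_eq_abs, sub_zero, abs_of_pos hL, mul_comm] at hle
  exact le_of_mul_le_mul_right hle hL

/-- Strong maximum principle: if `|G| ≤ M` on the graph and `|G| ≥ M` somewhere below it, then `G`
is constant. Infinite depth does not compete for the maximum, by
`IsPeriodicHolomorphic.exists_norm_limit_le`. -/
theorem IsPeriodicHolomorphic.eq_const_of_le_norm {h : ℝ → ℝ} {L : ℝ} {G : ℂ → ℂ} {ℓ : ℂ}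
    (hG : IsPeriodicHolomorphic h L G ℓ) (hL : 0 < L) (hhc : Continuous h)
    (hper : ∀ x, h (x + L) = h x) {M : ℝ} (hM : ∀ x : ℝ, ‖G (x + h x * I)‖ ≤ M) {z₀ : ℂ}
    (hz₀ : z₀ ∈ below h) (hle : M ≤ ‖G z₀‖) : ∃ a, ∀ z ∈ closedBelow h, G z = a := by
  suffices hmax : ∃ w ∈ below h, ∀ z ∈ closedBelow h, ‖G z‖ ≤ ‖G w‖ by
    obtain ⟨w, hw, hmax⟩ := hmax
    have hconst := eqOn_of_isPreconnected_of_isMaxOn_norm (isPreconnected_below hhc)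
      (isOpen_below hhc) hG.differentiableOn hw
      (fun z hz => hmax z (below_subset_closedBelow h hz))
    exact ⟨G w, hconst.of_subset_closure hG.continuousOn continuousOn_const
      (below_subset_closedBelow h) (closedBelow_subset_closure_below h)⟩
  obtain ⟨z₁, hz₁, hle₁⟩ := hG.exists_norm_limit_le hL hhc hper
  obtain ⟨z₂, hz₂, hM₂, hℓ₂⟩ : ∃ z ∈ below h, M ≤ ‖G z‖ ∧ ‖ℓ‖ ≤ ‖G z‖ := by
    rcases le_total ‖G z₀‖ ‖G z₁‖ with h01 | h10
    · exact ⟨z₁, hz₁, hle.trans h01, hle₁⟩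
    · exact ⟨z₀, hz₀, hle, hle₁.trans h10⟩
  by_cases hz : ∀ z ∈ closedBelow h, ‖G z‖ ≤ ‖G z₂‖
  · exact ⟨z₂, hz₂, hz⟩
  push Not at hz
  -- A value above `|ℓ|` is exceeded only in a part of the region that is compact modulo periods.
  obtain ⟨w, hw, hlt⟩ := hz
  have hev : ∀ᶠ z in comap im atBot, ‖G z‖ < ‖G w‖ :=
    hG.tendsto.norm.eventually_lt_const (hℓ₂.trans_lt hlt)
  obtain ⟨s, hs, hsub⟩ := hev
  obtain ⟨Y, hY⟩ := mem_atBot_sets.1 hs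
  have hdeep : ∀ z : ℂ, z.im ≤ Y → ‖G z‖ < ‖G w‖ := fun z hz => hsub (hY _ hz)
  obtain ⟨a, b, hb⟩ := exists_le_le_of_periodic hL hhc hper
  have hK : IsCompact ((Icc 0 L ×ℂ Icc Y b) ∩ closedBelow h) :=
    (isCompact_Icc.reProdIm isCompact_Icc).inter_right (isClosed_closedBelow hhc)
  have hred : ∀ z ∈ closedBelow h, ‖G w‖ ≤ ‖G z‖ →
      ∃ z' ∈ (Icc 0 L ×ℂ Icc Y b) ∩ closedBelow h, G z' = G z := by
    intro z hz hwz
    obtain ⟨n, hn⟩ := exists_add_int_mul_mem_Ico hL z.re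
    have hz' : z.im ≤ h z.re := hz
    refine ⟨z + n * L, ⟨⟨?_, ?_⟩, ?_⟩, hG.add_int_mul hper hz n⟩
    · simpa using Ico_subset_Icc_self hn
    · have h1 : Y ≤ z.im := by
        by_contra! hlt'
        exact absurd (hdeep z hlt'.le) (not_lt.2 hwz)
      simpa using ⟨h1, hz'.trans (hb _).2⟩
    · simpa [closedBelow, add_int_mul_eq_of_periodic hper] using hz'
  obtain ⟨w', hw', hGw'⟩ := hred w hw le_rfl
  obtain ⟨z₃, hz₃, hmax⟩ := hK.exists_isMaxOn ⟨w', hw'⟩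
    (hG.continuousOn.norm.mono inter_subset_right)
  have hw₃ : ‖G w‖ ≤ ‖G z₃‖ := hGw' ▸ hmax hw'
  have hle₃ : z₃.im ≤ h z₃.re := hz₃.2
  refine ⟨z₃, show z₃.im < h z₃.re from lt_of_le_of_ne hle₃ fun heq => ?_, fun z hz => ?_⟩
  · have := hM z₃.re
    rw [← heq, re_add_im] at this
    linarith
  · by_contra! hlt'
    obtain ⟨z', hz', hGz'⟩ := hred z hz (hw₃.trans hlt'.le)
    have : ‖G z'‖ ≤ ‖G z₃‖ := hmax hz'
    rw [hGz'] at this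
    linarith

/-! ### The complex velocity of a wave -/

/-- The complex velocity `(u - c) - i v` in the moving frame, as a function of `z = x + i y`. -/
noncomputable def complexVelocity (c : ℝ) (u v : ℝ → ℝ → ℝ) (z : ℂ) : ℂ :=
  ((u z.re z.im - c : ℝ) : ℂ) - ((v z.re z.im : ℝ) : ℂ) * I

@[simp] theorem complexVelocity_re (c : ℝ) (u v : ℝ → ℝ → ℝ) (z : ℂ) :
    (complexVelocity c u v z).re = u z.re z.im - c := by
  simp [complexVelocity]

@[simp] theorem complexVelocity_im (c : ℝ) (u v : ℝ → ℝ → ℝ) (z : ℂ) :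
    (complexVelocity c u v z).im = -v z.re z.im := by
  simp [complexVelocity]

theorem norm_complexVelocity_sq (c : ℝ) (u v : ℝ → ℝ → ℝ) (z : ℂ) :
    ‖complexVelocity c u v z‖ ^ 2 = (u z.re z.im - c) ^ 2 + v z.re z.im ^ 2 := by
  rw [← normSq_eq_norm_sq, normSq_apply, complexVelocity_re, complexVelocity_im]
  ring

theorem continuousOn_of_fluidDomain {η : ℝ → ℝ} {φ : ℝ → ℝ → ℝ}
    (hφ : ContDiffOn ℝ ∞ (fun q : ℝ × ℝ => φ q.1 q.2) (fluidDomain η)) :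
    ContinuousOn (fun z : ℂ => φ z.re z.im) (closedBelow η) :=
  hφ.continuousOn.comp (f := fun z : ℂ => (z.re, z.im)) (by fun_prop)
    (fun z hz => (show z.im ≤ η z.re from hz))

/-- Smoothness on the closed fluid domain makes the partial derivatives `dx` and `dy` genuine at
interior points. -/
theorem hasFDerivAt_of_fluidDomain {η : ℝ → ℝ} (hη : Continuous η) {φ : ℝ → ℝ → ℝ}
    (hφ : ContDiffOn ℝ ∞ (fun q : ℝ × ℝ => φ q.1 q.2) (fluidDomain η)) {z : ℂ}
    (hz : z ∈ below η) :
    HasFDerivAt (fun z : ℂ => φ z.re z.im)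
      (dx φ z.re z.im • reCLM + dy φ z.re z.im • imCLM) z := by
  have hnhds : fluidDomain η ∈ 𝓝 (z.re, z.im) := by
    have hopen : IsOpen {q : ℝ × ℝ | q.2 < η q.1} :=
      isOpen_lt continuous_snd (hη.comp continuous_fst)
    refine mem_of_superset (hopen.mem_nhds (show z.im < η z.re from hz)) fun q hq => ?_
    exact le_of_lt (show q.2 < η q.1 from hq)
  have hd := ((hφ.contDiffAt hnhds).differentiableAt (by simp)).hasFDerivAt
  have hx : dx φ z.re z.im = fderiv ℝ (fun q : ℝ × ℝ => φ q.1 q.2) (z.re, z.im) (1, 0) :=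
    (hd.comp_hasDerivAt (f := fun s : ℝ => (s, z.im)) z.re
      ((hasDerivAt_id z.re).prodMk (hasDerivAt_const z.re z.im))).deriv
  have hy : dy φ z.re z.im = fderiv ℝ (fun q : ℝ × ℝ => φ q.1 q.2) (z.re, z.im) (0, 1) :=
    (hd.comp_hasDerivAt (f := fun s : ℝ => (z.re, s)) z.im
      ((hasDerivAt_const z.im z.re).prodMk (hasDerivAt_id z.im))).deriv
  have hpair : HasFDerivAt (fun z : ℂ => (z.re, z.im)) (reCLM.prod imCLM) z :=
    reCLM.hasFDerivAt.prodMk imCLM.hasFDerivAt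
  refine (hd.comp (f := fun z : ℂ => (z.re, z.im)) z hpair).congr_fderiv ?_
  ext w
  have hw : (w.re, w.im) = w.re • ((1 : ℝ), (0 : ℝ)) + w.im • ((0 : ℝ), (1 : ℝ)) := by simp
  simp only [ContinuousLinearMap.comp_apply, ContinuousLinearMap.prod_apply, reCLM_apply,
    imCLM_apply, add_apply, smul_apply, hx, hy]
  rw [hw, map_add, map_smul, map_smul]
  simp [mul_comm]

section Wave

variable {c L g ρ Patm : ℝ} {η : ℝ → ℝ} {u v P : ℝ → ℝ → ℝ}

/-- Incompressibility and irrotationality are the Cauchy–Riemann equations of `(u - c) - i v`. -/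
theorem IsIrrotationalWave.isPeriodicHolomorphic
    (hw : IsIrrotationalWave c L g ρ Patm η u v P) :
    IsPeriodicHolomorphic η L (complexVelocity c u v) (-c) where
  continuousOn := by
    have hu := continuousOn_of_fluidDomain hw.smooth_u
    have hv := continuousOn_of_fluidDomain hw.smooth_v
    exact (continuous_ofReal.comp_continuousOn (hu.sub continuousOn_const)).sub
      ((continuous_ofReal.comp_continuousOn hv).mul continuousOn_const)
  differentiableOn := by
    intro z hz
    have hηc := hw.smooth_surface.continuous
    have hu := hasFDerivAt_of_fluidDomain hηc hw.smooth_u hz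
    have hv := hasFDerivAt_of_fluidDomain hηc hw.smooth_v hz
    have hf : HasFDerivAt (complexVelocity c u v)
        (ofRealCLM ∘L (dx u z.re z.im • reCLM + dy u z.re z.im • imCLM) -
          I • (ofRealCLM ∘L (dx v z.re z.im • reCLM + dy v z.re z.im • imCLM))) z :=
      (ofRealCLM.hasFDerivAt.comp z (hu.sub_const c)).sub
        ((ofRealCLM.hasFDerivAt.comp z hv).mul_const I)
    refine (differentiableAt_complex_iff_differentiableAt_real.2
      ⟨hf.differentiableAt, ?_⟩).differentiableWithinAt
    have h1 := hw.incompressible z.re z.im hz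
    have h2 := hw.irrotational z.re z.im hz
    rw [hf.fderiv]
    apply Complex.ext <;> simp <;> linarith
  periodic := by
    intro z hz
    simp [complexVelocity, hw.periodic_u z.re z.im hz, hw.periodic_v z.re z.im hz]
  tendsto := by
    have key : ∀ φ : ℝ → ℝ → ℝ, TendstoUniformly (fun y x => φ x y) (fun _ => 0) atBot →
        Tendsto (fun z : ℂ => φ z.re z.im) (comap im atBot) (𝓝 0) := by
      intro φ hφ
      rw [Metric.tendsto_nhds]
      intro ε hε
      refine mem_of_superset (preimage_mem_comap (Metric.tendstoUniformly_iff.1 hφ ε hε))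
        fun z hz => ?_
      have := hz z.re
      rwa [dist_comm] at this
    have hu := (continuous_ofReal.tendsto _).comp ((key u hw.decay_u).sub_const c)
    have hv := ((continuous_ofReal.tendsto _).comp (key v hw.decay_v)).mul_const I
    have hsum := hu.sub hv
    simp only [zero_sub, ofReal_zero, zero_mul, sub_zero, ofReal_neg] at hsum
    exact hsum

/-- Bernoulli's law: the total head is constant throughout the fluid. -/
theorem IsIrrotationalWave.bernoulli (hw : IsIrrotationalWave c L g ρ Patm η u v P) :
    ∃ B : ℝ, ∀ z ∈ closedBelow η,
      1 / ρ * P z.re z.im + g * z.im + ‖complexVelocity c u v z‖ ^ 2 / 2 = B := by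
  have hηc := hw.smooth_surface.continuous
  let E : ℂ → ℝ := fun z => 1 / ρ * P z.re z.im + g * z.im +
    ((u z.re z.im - c) ^ 2 + v z.re z.im ^ 2) / 2
  have hEd : ∀ z ∈ below η, HasFDerivAt E (0 : ℂ →L[ℝ] ℝ) z := by
    intro z hz
    have hu := (hasFDerivAt_of_fluidDomain hηc hw.smooth_u hz).sub_const c
    have hv := hasFDerivAt_of_fluidDomain hηc hw.smooth_v hz
    have hP := (hasFDerivAt_of_fluidDomain hηc hw.smooth_P hz).const_mul (1 / ρ)
    have him : HasFDerivAt (fun z : ℂ => g * z.im) (g • imCLM) z :=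
      imCLM.hasFDerivAt.const_mul g
    have hsum := (hP.add him).add (((hu.pow 2).add (hv.pow 2)).mul_const (1 / 2 : ℝ))
    have hE' := hsum.congr_of_eventuallyEq
      (f₁ := E) (Eventually.of_forall fun z => by simp [E]; ring)
    refine hE'.congr_fderiv ?_
    have h1 := hw.euler_x z.re z.im hz
    have h2 := hw.euler_y z.re z.im hz
    have h3 := hw.irrotational z.re z.im hz
    ext w
    simp
    linear_combination w.re * h1 + w.im * h2 - (w.re * v z.re z.im - w.im * (u z.re z.im - c)) * h3
  have hEc : ContinuousOn E (closedBelow η) := by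
    have hu := continuousOn_of_fluidDomain hw.smooth_u
    have hv := continuousOn_of_fluidDomain hw.smooth_v
    have hP := continuousOn_of_fluidDomain hw.smooth_P
    exact ((continuousOn_const.mul hP).add (by fun_prop)).add
      ((((hu.sub continuousOn_const).pow 2).add (hv.pow 2)).div_const 2)
  obtain ⟨B, hB⟩ := (isOpen_below hηc).exists_is_const_of_fderiv_eq_zero
    (isPreconnected_below hηc)
    (fun z hz => (hEd z hz).differentiableAt.differentiableWithinAt)
    (fun z hz => (hEd z hz).fderiv)
  have hB' : EqOn E (fun _ => B) (below η) := hB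
  have hBc := hB'.of_subset_closure hEc continuousOn_const
      (below_subset_closedBelow η) (closedBelow_subset_closure_below η)
  refine ⟨B, fun z hz => ?_⟩
  rw [norm_complexVelocity_sq]
  exact hBc hz

/-! ### Speed and elevation at the surface -/

/-- The dynamic pressure is a decreasing function of the speed, and the speed at the surface is a
decreasing function of the elevation. -/
theorem IsIrrotationalWave.exists_dynamicPressure_eq
    (hw : IsIrrotationalWave c L g ρ Patm η u v P) (hρ : 0 < ρ) :
    ∃ K : ℝ, (∀ x : ℝ, ‖complexVelocity c u v (x + η x * I)‖ ^ 2 = K - 2 * g * η x) ∧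
      ∀ z ∈ closedBelow η, dynamicPressure g ρ Patm P (z.re, z.im) =
        ρ / 2 * (K - ‖complexVelocity c u v z‖ ^ 2) := by
  obtain ⟨B, hB⟩ := hw.bernoulli
  have hp : ∀ z ∈ closedBelow η, dynamicPressure g ρ Patm P (z.re, z.im) =
      ρ / 2 * (2 * (B - Patm / ρ) - ‖complexVelocity c u v z‖ ^ 2) := by
    intro z hz
    rw [← hB z hz, dynamicPressure]
    field_simp
    ring
  refine ⟨2 * (B - Patm / ρ), fun x => ?_, hp⟩
  have h1 := hp (x + η x * I) (by simp [closedBelow])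
  simp only [add_re, add_im, mul_re, mul_im, ofReal_re, ofReal_im, I_re, I_im, mul_zero, mul_one,
    sub_zero, add_zero, zero_add, dynamicPressure, hw.dynamic x] at h1
  have h2 : ρ * (2 * g * η x - (2 * (B - Patm / ρ) -
      ‖complexVelocity c u v (x + η x * I)‖ ^ 2)) = 0 := by linear_combination 2 * h1
  have h3 := (mul_eq_zero.1 h2).resolve_left hρ.ne'
  linarith

theorem IsIrrotationalWave.norm_complexVelocity_surface_sq
    (hw : IsIrrotationalWave c L g ρ Patm η u v P) (x : ℝ) :
    ‖complexVelocity c u v (x + η x * I)‖ ^ 2 =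
      (u x (η x) - c) ^ 2 * (1 + deriv η x ^ 2) := by
  rw [norm_complexVelocity_sq]
  simp only [add_re, add_im, mul_re, mul_im, ofReal_re, ofReal_im, I_re, I_im, mul_zero, mul_one,
    sub_zero, add_zero, zero_add, hw.kinematic x]
  ring

/-- The circulation along the surface, computed at infinite depth. The integrand is real because
the surface is a streamline. -/
theorem IsIrrotationalWave.integral_surface (hw : IsIrrotationalWave c L g ρ Patm η u v P) :
    ∫ x in (0 : ℝ)..L, (u x (η x) - c) * (1 + deriv η x ^ 2) = -(c * L) := by
  have hmean := hw.isPeriodicHolomorphic.integral_graph_eq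
    (contDiff_infty.1 hw.smooth_surface 2) hw.periodic_surface
  have hreal : ∀ x : ℝ, complexVelocity c u v (x + η x * I) * (1 + deriv η x * I) =
      (((u x (η x) - c) * (1 + deriv η x ^ 2) : ℝ) : ℂ) := by
    intro x
    simp only [complexVelocity, add_re, add_im, mul_re, mul_im, ofReal_re, ofReal_im, I_re, I_im,
      mul_zero, mul_one, sub_zero, add_zero, zero_add, hw.kinematic x]
    push_cast
    linear_combination (-(u x (η x) - c) * deriv η x ^ 2 : ℂ) * I_sq
  simp only [hreal, intervalIntegral.integral_ofReal] at hmean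
  have := congrArg re hmean
  simpa [mul_comm] using this

/-! ### Crests and troughs -/

theorem IsRegularWaveTrain.surface_lt_crest (hw : IsRegularWaveTrain c L g ρ Patm η u v P)
    {x : ℝ} (hx : x ∈ Ioo 0 L) : η x < η 0 := by
  have hL : 0 < L := hx.1.trans hx.2
  rcases le_or_gt x (L / 2) with h | h
  · exact hw.strictAnti_crest_trough ⟨le_rfl, by linarith⟩ ⟨hx.1.le, h⟩ hx.1
  · have h0 := hw.periodic_surface 0
    rw [zero_add] at h0
    rw [← h0]
    exact hw.strictMono_trough_crest ⟨h.le, hx.2.le⟩ ⟨by linarith, le_rfl⟩ hx.2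

theorem IsRegularWaveTrain.trough_lt_surface (hw : IsRegularWaveTrain c L g ρ Patm η u v P)
    {x : ℝ} (hx : x ∈ Ico 0 L) (hne : x ≠ L / 2) : η (L / 2) < η x := by
  have hL : 0 < L := hx.1.trans_lt hx.2
  rcases lt_or_gt_of_ne hne with h | h
  · exact hw.strictAnti_crest_trough ⟨hx.1, h.le⟩ ⟨by linarith, le_rfl⟩ h
  · exact hw.strictMono_trough_crest ⟨le_rfl, by linarith⟩ ⟨h.le, hx.2.le⟩ h

theorem IsRegularWaveTrain.surface_le_crest (hw : IsRegularWaveTrain c L g ρ Patm η u v P)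
    (hL : 0 < L) (x : ℝ) : η x ≤ η 0 ∧ (η x = η 0 → ∃ n : ℤ, x = n * L) := by
  obtain ⟨n, hn⟩ := exists_add_int_mul_mem_Ico hL x
  rw [← add_int_mul_eq_of_periodic hw.periodic_surface x n]
  rcases hn.1.eq_or_lt with h | h
  · refine ⟨by rw [← h], fun _ => ⟨-n, ?_⟩⟩
    push_cast
    linarith
  · have := hw.surface_lt_crest ⟨h, hn.2⟩
    exact ⟨this.le, fun heq => absurd heq this.ne⟩

theorem IsRegularWaveTrain.trough_le_surface (hw : IsRegularWaveTrain c L g ρ Patm η u v P)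
    (hL : 0 < L) (x : ℝ) :
    η (L / 2) ≤ η x ∧ (η x = η (L / 2) → ∃ n : ℤ, x = L / 2 + n * L) := by
  obtain ⟨n, hn⟩ := exists_add_int_mul_mem_Ico hL x
  rw [← add_int_mul_eq_of_periodic hw.periodic_surface x n]
  by_cases h : x + n * L = L / 2
  · refine ⟨by rw [h], fun _ => ⟨-n, ?_⟩⟩
    push_cast
    linarith
  · have := hw.trough_lt_surface hn h
    exact ⟨this.le, fun heq => absurd heq this.ne'⟩

/-! ### Absence of stagnation points -/

/-- On the surface the fluid nowhere outruns the wave. Off the crests the speed is positive, so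
`u - c` has one sign there, and the sign of the circulation decides which. -/
theorem IsRegularWaveTrain.surface_velocity_le (hw : IsRegularWaveTrain c L g ρ Patm η u v P)
    (hc : 0 < c) (hL : 0 < L) (hg : 0 < g) (hρ : 0 < ρ) (x : ℝ) : u x (η x) - c ≤ 0 := by
  have hηc := hw.smooth_surface.continuous
  set U : ℝ → ℝ := fun x => u x (η x) - c with hU
  have hUc : Continuous U := by
    have hu : Continuous fun x : ℝ => (fun q : ℝ × ℝ => u q.1 q.2) (x, η x) :=
      hw.smooth_u.continuousOn.comp_continuous (by fun_prop) fun x => le_refl (η x)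
    exact hu.sub continuous_const
  obtain ⟨K, hK, -⟩ := hw.exists_dynamicPressure_eq hρ
  have hne : ∀ x ∈ Ioo 0 L, U x ≠ 0 := by
    intro x hx h0
    have h1 := hK x
    rw [hw.norm_complexVelocity_surface_sq x, show u x (η x) - c = 0 from h0] at h1
    have h2 := hK 0
    have h3 := sq_nonneg ‖complexVelocity c u v ((0 : ℝ) + η 0 * I)‖
    have h4 := mul_lt_mul_of_pos_left (hw.surface_lt_crest hx) hg
    linarith
  have hneg : ∀ x ∈ Ioo 0 L, U x < 0 := by
    by_contra! hpos
    obtain ⟨x₁, hx₁, hpos₁⟩ := hpos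
    have hall : ∀ x ∈ Ioo 0 L, 0 ≤ U x := by
      intro x hx
      by_contra! hlt
      obtain ⟨x₂, hx₂, h0⟩ := isPreconnected_Ioo.intermediate_value hx hx₁ hUc.continuousOn
        ⟨hlt.le, hpos₁⟩
      exact hne x₂ hx₂ h0
    have hint : 0 ≤ ∫ x in (0 : ℝ)..L, U x * (1 + deriv η x ^ 2) := by
      refine integral_nonneg_of_ae_restrict hL.le ?_
      rw [← MeasureTheory.Measure.restrict_congr_set MeasureTheory.Ioo_ae_eq_Icc]
      exact (MeasureTheory.ae_restrict_mem measurableSet_Ioo).mono fun x hx =>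
        mul_nonneg (hall x hx) (by positivity)
    rw [hw.integral_surface] at hint
    have := mul_pos hc hL
    linarith
  have hUper : ∀ x, U (x + L) = U x := by
    intro x
    simp only [hU, hw.periodic_surface x, hw.periodic_u x (η x) le_rfl]
  obtain ⟨n, hn⟩ := exists_add_int_mul_mem_Ico hL x
  change U x ≤ 0
  rw [← add_int_mul_eq_of_periodic hUper x n]
  have hclosure : x + n * L ∈ closure (Ioo 0 L) := by
    rw [closure_Ioo hL.ne]
    exact Ico_subset_Icc_self hn
  exact closure_minimal (fun x hx => (hneg x hx).le)
    (isClosed_le hUc continuous_const) hclosure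

/-- In the interior the fluid moves strictly slower than the wave, by the maximum principle for
`exp f`, whose modulus is `exp (u - c)`. -/
theorem IsRegularWaveTrain.velocity_lt (hw : IsRegularWaveTrain c L g ρ Patm η u v P)
    (hc : 0 < c) (hL : 0 < L) (hg : 0 < g) (hρ : 0 < ρ) {z : ℂ} (hz : z ∈ below η) :
    u z.re z.im - c < 0 := by
  have hηc := hw.smooth_surface.continuous
  have hexp := hw.isPeriodicHolomorphic.comp (Φ := Complex.exp)
    (fun _ _ => Complex.differentiableAt_exp) Complex.continuous_exp.continuousAt
  by_contra! hge
  have hz1 : 1 ≤ ‖Complex.exp (complexVelocity c u v z)‖ := by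
    rw [Complex.norm_exp, complexVelocity_re]
    exact Real.one_le_exp hge
  obtain ⟨a, ha⟩ := hexp.eq_const_of_le_norm hL hηc hw.periodic_surface (M := 1) (by
    intro x
    rw [Complex.norm_exp, complexVelocity_re, Real.exp_le_one_iff]
    simpa using hw.surface_velocity_le hc hL hg hρ x) hz hz1
  -- The constant is its own limit, but the limit `exp (-c)` has modulus less than one.
  have hne : (comap im atBot).NeBot := atBot_neBot.comap_of_surj fun y => ⟨y * I, by simp⟩
  obtain ⟨m, b, hm⟩ := exists_le_le_of_periodic hL hηc hw.periodic_surface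
  have hlim : Tendsto (fun z => Complex.exp (complexVelocity c u v z)) (comap im atBot) (𝓝 a) := by
    refine tendsto_const_nhds.congr' ?_
    refine mem_of_superset (preimage_mem_comap (Iic_mem_atBot m)) fun z hz => (ha z ?_).symm
    exact le_trans (show z.im ≤ m from hz) (hm z.re).1
  have heq := tendsto_nhds_unique hlim hexp.tendsto
  rw [ha z (below_subset_closedBelow η hz), heq, Complex.norm_exp] at hz1
  simp at hz1
  linarith

/-! ### Extrema of the speed -/

/-- A constant complex velocity would force a flat surface, by Bernoulli's law. -/
theorem IsRegularWaveTrain.complexVelocity_not_const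
    (hw : IsRegularWaveTrain c L g ρ Patm η u v P) (hL : 0 < L) (hg : 0 < g) (hρ : 0 < ρ) (a : ℂ) :
    ¬ ∀ z ∈ closedBelow η, complexVelocity c u v z = a := by
  intro ha
  obtain ⟨K, hK, -⟩ := hw.exists_dynamicPressure_eq hρ
  have hmem : ∀ x : ℝ, (x : ℂ) + η x * I ∈ closedBelow η := fun x => by simp [closedBelow]
  have h0 := hK 0
  have h1 := hK (L / 2)
  rw [ha _ (hmem _)] at h0 h1
  have := mul_lt_mul_of_pos_left
    (hw.surface_lt_crest (x := L / 2) ⟨by linarith, by linarith⟩) hg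
  linarith

theorem IsRegularWaveTrain.norm_complexVelocity_lt (hw : IsRegularWaveTrain c L g ρ Patm η u v P)
    (hL : 0 < L) (hg : 0 < g) (hρ : 0 < ρ) {z : ℂ} (hz : z ∈ below η) :
    ‖complexVelocity c u v z‖ < ‖complexVelocity c u v ((L / 2 : ℝ) + η (L / 2) * I)‖ := by
  obtain ⟨K, hK, -⟩ := hw.exists_dynamicPressure_eq hρ
  by_contra! hge
  obtain ⟨a, ha⟩ := hw.isPeriodicHolomorphic.eq_const_of_le_norm hL
    hw.smooth_surface.continuous hw.periodic_surface (fun x => by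
      refine (sq_le_sq₀ (norm_nonneg _) (norm_nonneg _)).1 ?_
      rw [hK, hK]
      have := mul_le_mul_of_nonneg_left (hw.trough_le_surface hL x).1 hg.le
      linarith) hz hge
  exact hw.complexVelocity_not_const hL hg hρ a ha

theorem IsRegularWaveTrain.lt_norm_complexVelocity (hw : IsRegularWaveTrain c L g ρ Patm η u v P)
    (hc : 0 < c) (hL : 0 < L) (hg : 0 < g) (hρ : 0 < ρ) {z : ℂ} (hz : z ∈ below η) :
    ‖complexVelocity c u v ((0 : ℝ) + η 0 * I)‖ < ‖complexVelocity c u v z‖ := by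
  obtain ⟨K, hK, -⟩ := hw.exists_dynamicPressure_eq hρ
  by_contra! hle
  -- The point `z` rules out a zero at the crest, so `1 / f` is defined up to the surface.
  have hne_below : ∀ w ∈ below η, complexVelocity c u v w ≠ 0 := by
    intro w hw' h0
    have := hw.velocity_lt hc hL hg hρ hw'
    rw [← complexVelocity_re c u v w, h0, zero_re] at this
    exact this.false
  have hpos : 0 < ‖complexVelocity c u v ((0 : ℝ) + η 0 * I)‖ :=
    (norm_pos_iff.2 (hne_below z hz)).trans_le hle
  have hsurface : ∀ x : ℝ, ‖complexVelocity c u v ((0 : ℝ) + η 0 * I)‖ ≤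
      ‖complexVelocity c u v (x + η x * I)‖ := by
    intro x
    refine (sq_le_sq₀ (norm_nonneg _) (norm_nonneg _)).1 ?_
    rw [hK, hK]
    have := mul_le_mul_of_nonneg_left (hw.surface_le_crest hL x).1 hg.le
    linarith
  have hne : ∀ w ∈ closedBelow η, complexVelocity c u v w ≠ 0 := by
    intro w hw'
    rcases (show w.im ≤ η w.re from hw').lt_or_eq with h | h
    · exact hne_below w h
    · have := hpos.trans_le (hsurface w.re)
      rwa [← h, re_add_im, norm_pos_iff] at this
  have hinv := hw.isPeriodicHolomorphic.comp (Φ := fun w => w⁻¹)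
    (fun w hw' => differentiableAt_inv (hne w hw'))
    (continuousAt_inv₀ (by simpa using hc.ne'))
  obtain ⟨a, ha⟩ := hinv.eq_const_of_le_norm hL hw.smooth_surface.continuous hw.periodic_surface
    (fun x => by
      rw [norm_inv]
      exact inv_anti₀ hpos (hsurface x)) hz (by
      rw [norm_inv]
      exact inv_anti₀ (norm_pos_iff.2 (hne_below z hz)) hle)
  exact hw.complexVelocity_not_const hL hg hρ a⁻¹ fun w hw' => inv_eq_iff_eq_inv.1 (ha w hw')

/-- The dynamic pressure at interior points lies strictly between its values at trough and
crest. -/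
theorem IsRegularWaveTrain.dynamicPressure_mem_Ioo
    (hw : IsRegularWaveTrain c L g ρ Patm η u v P)
    (hc : 0 < c) (hL : 0 < L) (hg : 0 < g) (hρ : 0 < ρ) {x y : ℝ} (hy : y < η x) :
    dynamicPressure g ρ Patm P (x, y) ∈ Ioo (ρ * g * η (L / 2)) (ρ * g * η 0) := by
  obtain ⟨K, hK, hp⟩ := hw.exists_dynamicPressure_eq hρ
  have hz : (⟨x, y⟩ : ℂ) ∈ below η := hy
  have h1 := hw.norm_complexVelocity_lt hL hg hρ hz
  have h2 := hw.lt_norm_complexVelocity hc hL hg hρ hz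
  rw [← sq_lt_sq₀ (norm_nonneg _) (norm_nonneg _), hK] at h1 h2
  rw [hp ⟨x, y⟩ hy.le]
  constructor <;> nlinarith

theorem IsIrrotationalWave.dynamicPressure_surface
    (hw : IsIrrotationalWave c L g ρ Patm η u v P) (x : ℝ) :
    dynamicPressure g ρ Patm P (x, η x) = ρ * g * η x := by
  simp [dynamicPressure, hw.dynamic x]

end Wave

end DeepWater

theorem theorem2 (c L g ρ Patm : ℝ) (hc : 0 < c) (hL : 0 < L) (hg : 0 < g) (hρ : 0 < ρ)
    (η : ℝ → ℝ) (u v P : ℝ → ℝ → ℝ)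
    (hwave : DeepWater.IsRegularWaveTrain c L g ρ Patm η u v P)
    (hcurrent : DeepWater.NoUnderlyingCurrent L η u) :
    -- the maximum is attained at the crest
    IsMaxOn (DeepWater.dynamicPressure g ρ Patm P) (DeepWater.fluidDomain η) (0, η 0) ∧
    -- the minimum is attained at the trough
    IsMinOn (DeepWater.dynamicPressure g ρ Patm P) (DeepWater.fluidDomain η)
      (L / 2, η (L / 2)) ∧
    -- the maximum is attained at no other points than the crests
    (∀ q ∈ DeepWater.fluidDomain η,
      IsMaxOn (DeepWater.dynamicPressure g ρ Patm P) (DeepWater.fluidDomain η) q →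
        ∃ n : ℤ, q = (n * L, η (n * L))) ∧
    -- the minimum is attained at no other points than the troughs
    (∀ q ∈ DeepWater.fluidDomain η,
      IsMinOn (DeepWater.dynamicPressure g ρ Patm P) (DeepWater.fluidDomain η) q →
        ∃ n : ℤ, q = (L / 2 + n * L, η (L / 2 + n * L))) := by
  have hw := hwave.toIsIrrotationalWave
  have hρg : 0 < ρ * g := mul_pos hρ hg
  have hle : ∀ q ∈ DeepWater.fluidDomain η,
      DeepWater.dynamicPressure g ρ Patm P q ≤ ρ * g * η 0 ∧
      ρ * g * η (L / 2) ≤ DeepWater.dynamicPressure g ρ Patm P q := by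
    rintro ⟨x, y⟩ hq
    rcases (show y ≤ η x from hq).lt_or_eq with h | rfl
    · have := hwave.dynamicPressure_mem_Ioo hc hL hg hρ h
      exact ⟨this.2.le, this.1.le⟩
    · rw [hw.dynamicPressure_surface]
      exact ⟨mul_le_mul_of_nonneg_left (hwave.surface_le_crest hL x).1 hρg.le,
        mul_le_mul_of_nonneg_left (hwave.trough_le_surface hL x).1 hρg.le⟩
  refine ⟨fun q hq => ?_, fun q hq => ?_, ?_, ?_⟩
  · exact (hle q hq).1.trans_eq (hw.dynamicPressure_surface 0).symm
  · exact (hw.dynamicPressure_surface (L / 2)).trans_le (hle q hq).2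
  · rintro ⟨x, y⟩ hq hmax
    have hcrest : (0, η 0) ∈ DeepWater.fluidDomain η := le_refl (η 0)
    have h0 : ρ * g * η 0 ≤ DeepWater.dynamicPressure g ρ Patm P (x, y) :=
      (hw.dynamicPressure_surface 0).symm.trans_le (hmax hcrest)
    rcases (show y ≤ η x from hq).lt_or_eq with h | rfl
    · exact absurd h0 (not_le.2 (hwave.dynamicPressure_mem_Ioo hc hL hg hρ h).2)
    · rw [hw.dynamicPressure_surface] at h0
      obtain ⟨n, rfl⟩ := (hwave.surface_le_crest hL x).2
        (le_antisymm (hwave.surface_le_crest hL x).1 (le_of_mul_le_mul_left h0 hρg))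
      exact ⟨n, rfl⟩
  · rintro ⟨x, y⟩ hq hmin
    have htrough : (L / 2, η (L / 2)) ∈ DeepWater.fluidDomain η := le_refl (η (L / 2))
    have h0 : DeepWater.dynamicPressure g ρ Patm P (x, y) ≤ ρ * g * η (L / 2) :=
      (hmin htrough).trans_eq (hw.dynamicPressure_surface (L / 2))
    rcases (show y ≤ η x from hq).lt_or_eq with h | rfl
    · exact absurd h0 (not_le.2 (hwave.dynamicPressure_mem_Ioo hc hL hg hρ h).1)
    · rw [hw.dynamicPressure_surface] at h0
      obtain ⟨n, rfl⟩ := (hwave.trough_le_surface hL x).2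
        (le_antisymm (le_of_mul_le_mul_left h0 hρg) (hwave.trough_le_surface hL x).1)
      exact ⟨n, rfl⟩
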